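/- Let $V$ be a real Euclidean space of dimension $n\ge 0$ and let $\mathcal A$ be an essential finite arrangement of affine hyperplanes in $V$ (essential means that the normal vectors of the hyperplanes span $V$). Let $L(\mathcal A)$ be its intersection poset: the nonempty intersections of hyperplanes of $\mathcal A$, including $V$ itself as the empty intersection, ordered by reverse inclusion and ranked by codimension. For a set $I=\{i_1<\dots<i_k\}\subseteq\{1,\dots,n\}$ let $W_I$ be the number of $k$-tuples $(X_1,\dots,X_k)$ in $L(\mathcal A)$ with $X_1\le X_2\le\cdots\le X_k$ and $\operatorname{rk}X_j=i_j$ for all $j$ (so $W_\emptyset=1$), and let $u(I)$ be the largest element of $I$, with $u(\emptyset)=0$. A region is a connected component of the complement $V\setminus\bigcup_{H\in\mathcal A}H$, and a region is relatively bounded if its intersection with the linear span of the normal vectors of the hyperplanes is bounded. Then $\mathcal A$ has finitely many regions, the number $a(\mathcal A)$ of regions is $$a(\mathcal A)=\sum_{I\subseteq\{1,\dots,n\}}(-1)^{|I|+u(I)}\,W_I ,$$ and the number $b(\mathcal A)$ of relatively bounded regions is $$b(\mathcal A)=(-1)^n\sum_{I\subseteq\{1,\dots,n\}}(-1)^{|I|}\,W_I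 .$$ -/

import Mathlib

/-- The multi-indexed Whitney number of the second kind `W_I(P)` of a finite ranked poset `P`,
for a tuple `I = (i₁, …, i_k)`: the sum of `ζ_k = 1` over all `X₁ ≤ ⋯ ≤ X_k` in `P`
with `rk X_j = i_j` for all `j`. Ranks are those of the `GradeMinOrder` structure. -/
noncomputable def whitneyTuple (P : Type*) [PartialOrder P] [GradeMinOrder ℕ P] [Finite P]
    {k : ℕ} (i : Fin k → ℕ) : ℕ :=
  Nat.card {X : Fin k → P // Monotone X ∧ ∀ j, grade ℕ (X j) = i j}

/-- `W_I(P)` for a finite set `I` of ranks, listed in increasing order.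
For `I = ∅` there is exactly one (empty) tuple, so `W_∅ = 1`. -/
noncomputable def whitney (P : Type*) [PartialOrder P] [GradeMinOrder ℕ P] [Finite P]
    (I : Finset ℕ) : ℕ :=
  whitneyTuple P (I.orderEmbOfFin rfl)

/-- A (finite, affine) real hyperplane arrangement in `V`: a finite set of nonempty affine
subspaces of codimension one. -/
structure HyperplaneArrangement (V : Type*) [NormedAddCommGroup V] [InnerProductSpace ℝ V] where
  hyperplanes : Set (AffineSubspace ℝ V)
  finite : hyperplanes.Finite
  nonempty : ∀ H ∈ hyperplanes, (H : Set V).Nonempty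
  codim_eq_one : ∀ H ∈ hyperplanes, Module.finrank ℝ (V ⧸ H.direction) = 1

namespace HyperplaneArrangement

variable {V : Type*} [NormedAddCommGroup V] [InnerProductSpace ℝ V]

/-- The linear span of the normal vectors of the hyperplanes. -/
noncomputable def normalSpace (A : HyperplaneArrangement V) : Submodule ℝ V :=
  ⨆ H ∈ A.hyperplanes, H.directionᗮ

/-- The rank of an arrangement is the dimension of the span of its normals;
it is essential if this is the dimension of the ambient space. -/
def IsEssential (A : HyperplaneArrangement V) : Prop :=
  Module.finrank ℝ A.normalSpace = Module.finrank ℝ V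

/-- The complement of the union of the hyperplanes. -/
def complement (A : HyperplaneArrangement V) : Set V :=
  {x | ∀ H ∈ A.hyperplanes, x ∉ H}

/-- The regions: connected components of the complement. -/
def regions (A : HyperplaneArrangement V) : Set (Set V) :=
  {R | ∃ x ∈ A.complement, R = connectedComponentIn A.complement x}

/-- The relatively bounded regions: those whose intersection with the span of the normals
is bounded. -/
def relativelyBoundedRegions (A : HyperplaneArrangement V) : Set (Set V) :=
  {R | R ∈ A.regions ∧ Bornology.IsBounded (R ∩ (A.normalSpace : Set V))}

/-- The intersection poset `L(A)`: all nonempty intersections of hyperplanes of `A`, including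
the empty intersection `V`. -/
@[ext] structure IntersectionPoset (A : HyperplaneArrangement V) where
  flat : AffineSubspace ℝ V
  nonempty : (flat : Set V).Nonempty
  exists_sInf : ∃ B ⊆ A.hyperplanes, flat = sInf B

namespace IntersectionPoset

variable {A : HyperplaneArrangement V}

/-- `L(A)` is ordered by reverse inclusion. -/
instance : PartialOrder A.IntersectionPoset :=
  PartialOrder.lift (fun X => OrderDual.toDual X.flat) fun X Y h => by
    ext1
    exact h

theorem le_iff {X Y : A.IntersectionPoset} : X ≤ Y ↔ Y.flat ≤ X.flat := Iff.rfl

theorem lt_iff {X Y : A.IntersectionPoset} : X < Y ↔ Y.flat < X.flat := Iff.rfl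

instance : Finite A.IntersectionPoset := by
  have hfin : (sInf '' {B | B ⊆ A.hyperplanes}).Finite := A.finite.finite_subsets.image _
  have := hfin.to_subtype
  refine Finite.of_injective
    (fun X : A.IntersectionPoset =>
      (⟨X.flat, by
        obtain ⟨B, hB, h⟩ := X.exists_sInf
        exact ⟨B, hB, h.symm⟩⟩ : (sInf '' {B | B ⊆ A.hyperplanes} : Set _))) ?_
  intro X Y h
  ext1
  exact congrArg Subtype.val h

/-- The rank of a flat is its codimension. -/
noncomputable def codim (X : A.IntersectionPoset) : ℕ := Module.finrank ℝ (V ⧸ X.flat.direction)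

variable [FiniteDimensional ℝ V]

theorem codim_strictMono : StrictMono (codim : A.IntersectionPoset → ℕ) := by
  intro X Y h
  have h1 := Submodule.finrank_lt_finrank_of_lt
    (AffineSubspace.direction_lt_of_nonempty (lt_iff.1 h) Y.nonempty)
  have h2 := Submodule.finrank_quotient_add_finrank X.flat.direction
  have h3 := Submodule.finrank_quotient_add_finrank Y.flat.direction
  unfold codim
  omega

theorem codim_covBy {X Y : A.IntersectionPoset} (h : X ⋖ Y) : codim X ⋖ codim Y := by
  obtain ⟨B, hB, hY⟩ := Y.exists_sInf
  obtain ⟨C, hC, hX⟩ := X.exists_sInf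
  have hlt := lt_iff.1 h.lt
  obtain ⟨H, hHB, hXH⟩ : ∃ H ∈ B, ¬ X.flat ≤ H := by
    by_contra! hcon
    exact absurd (hlt.trans_le ((le_sInf hcon).trans_eq hY.symm)) (lt_irrefl _)
  have hYH : Y.flat ≤ H := hY ▸ sInf_le hHB
  obtain ⟨y, hy⟩ := Y.nonempty
  have hyX : y ∈ X.flat := hlt.le hy
  have hyH : y ∈ H := hYH hy
  let Z : A.IntersectionPoset :=
    ⟨X.flat ⊓ H, ⟨y, hyX, hyH⟩, insert H C, Set.insert_subset (hB hHB) hC, by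
      rw [sInf_insert, hX, inf_comm]⟩
  have hXZ : X < Z := lt_iff.2 (inf_le_left.lt_of_ne fun e => hXH (inf_eq_left.1 e))
  have hZY : Z ≤ Y := le_iff.2 (le_inf hlt.le hYH)
  have hZ : Z = Y := (h.eq_or_eq hXZ.le hZY).resolve_left hXZ.ne'
  have hdir : Y.flat.direction = X.flat.direction ⊓ H.direction := by
    rw [← hZ]
    exact AffineSubspace.direction_inf_of_mem hyX hyH
  have h1 := Submodule.finrank_sup_add_finrank_inf_eq X.flat.direction H.direction
  rw [← hdir] at h1
  have h2 := Submodule.finrank_quotient_add_finrank X.flat.direction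
  have h3 := Submodule.finrank_quotient_add_finrank Y.flat.direction
  have h4 := Submodule.finrank_quotient_add_finrank H.direction
  have h5 := A.codim_eq_one H (hB hHB)
  have h6 := Submodule.finrank_le (X.flat.direction ⊔ H.direction)
  have h7 := codim_strictMono h.lt
  rw [Nat.covBy_iff_add_one_eq]
  unfold codim at *
  omega

theorem codim_isMin {X : A.IntersectionPoset} (h : IsMin X) : IsMin (codim X) := by
  let T : A.IntersectionPoset := ⟨⊤, ⟨0, trivial⟩, ∅, Set.empty_subset _, sInf_empty.symm⟩
  have hT : T.flat ≤ X.flat := le_iff.1 (h (le_iff.2 le_top : T ≤ X))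
  have hX : X.flat = ⊤ := top_le_iff.1 hT
  have h2 := Submodule.finrank_quotient_add_finrank X.flat.direction
  have h0 : codim X = 0 := by
    unfold codim
    rw [hX, AffineSubspace.direction_top, finrank_top] at *
    omega
  rw [h0]
  exact isMin_bot

/-- `L(A)` is a ranked poset, with the codimension as rank function. -/
noncomputable instance : GradeMinOrder ℕ A.IntersectionPoset where
  grade := codim
  grade_strictMono := codim_strictMono
  covBy_grade := fun _ _ h => codim_covBy h
  isMin_grade := fun _ h => codim_isMin h

end IntersectionPoset

end HyperplaneArrangement

/-! Write `μ` for the Möbius function `μ(V, X)` of the intersection poset. Both formulas combine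
Zaslavsky's theorem with Philip Hall's theorem.

Poset side: grouping chains of nonminimal flats by their set of ranks and applying Hall's theorem
turns `∑ (-1)^|I| g(max I) W_I` into `∑ μ(X) g(rk X)` for every `g` (`sum_whitney_eq_sum_chains`,
`sum_chainsIn_eq_sum_moebius`). Up to the global sign `(-1)^n`, the choices `g k = (-1)^k` and `g =
1` give the two right-hand sides. By Whitney's theorem `μ(X)` is the signed number of sets of
hyperplanes with intersection `X` (`sum_signedCount`), so these sums are instances of `whitneySum`.

Geometric side: `whitneySum` satisfies a deletion-restriction recursion by its very form. Regions
are the nonempty sign cells, and cutting cells by one more hyperplane `H` gives the same recursion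
for their number. The induction runs over the set `F` of hyperplanes with an arbitrary affine
subspace `E` as ambient space: restriction only replaces `E` by `E ⊓ H`, whatever degeneracies
appear there.

For bounded regions, boundedness is replaced by the absence of recession vectors. Deleting `H` may
destroy essentiality, the hypothesis `Separates`; in that case both sides vanish
(`boundedCellCount_eq`). -/

/-- Sum over all subsets `B` of `F` of `(-1) ^ #B` times the weight of `E ∩ ⋂ B`. -/
noncomputable def whitneySum {V : Type*} [NormedAddCommGroup V] [InnerProductSpace ℝ V]
    (w : AffineSubspace ℝ V → ℤ) (E : AffineSubspace ℝ V) (F : Finset (AffineSubspace ℝ V)) : ℤ :=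
  ∑ B ∈ F.powerset, (-1 : ℤ) ^ B.card * w (E ⊓ sInf (B : Set (AffineSubspace ℝ V)))

/-! ### Sign cells of an affine subspace -/

namespace Cells

variable {V : Type*} [NormedAddCommGroup V] [InnerProductSpace ℝ V]

open Classical in
/-- The sign attached to `H` by the set `S` of hyperplanes on whose positive side we are. -/
noncomputable def sgn (S : Finset (AffineSubspace ℝ V)) (H : AffineSubspace ℝ V) : ℝ :=
  if H ∈ S then 1 else -1

/-- The points of `E` on the positive side of the hyperplanes `l H = c H` with `H ∈ F ∩ S`, and on
the negative side of those with `H ∈ F \ S`. -/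
def cell (l : AffineSubspace ℝ V → V →L[ℝ] ℝ) (c : AffineSubspace ℝ V → ℝ)
    (E : AffineSubspace ℝ V) (F S : Finset (AffineSubspace ℝ V)) : Set V :=
  {x | x ∈ E ∧ ∀ H ∈ F, 0 < sgn S H * (l H x - c H)}

/-- The cell with sign set `S` has no nonzero recession vector. -/
def NoRec (l : AffineSubspace ℝ V → V →L[ℝ] ℝ)
    (E : AffineSubspace ℝ V) (F S : Finset (AffineSubspace ℝ V)) : Prop :=
  ∀ v ∈ E.direction, (∀ H ∈ F, 0 ≤ sgn S H * l H v) → v = 0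

/-- The linear forms `l H`, for `H ∈ F`, separate the points of `E`. -/
def Separates (l : AffineSubspace ℝ V → V →L[ℝ] ℝ)
    (E : AffineSubspace ℝ V) (F : Finset (AffineSubspace ℝ V)) : Prop :=
  ∀ v ∈ E.direction, (∀ H ∈ F, l H v = 0) → v = 0

variable {l : AffineSubspace ℝ V → V →L[ℝ] ℝ} {c : AffineSubspace ℝ V → ℝ}
  {E H : AffineSubspace ℝ V} {F S : Finset (AffineSubspace ℝ V)}

theorem sgn_cases (S : Finset (AffineSubspace ℝ V)) (H : AffineSubspace ℝ V) :
    sgn S H = 1 ∨ sgn S H = -1 := by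
  unfold sgn; split_ifs <;> simp

theorem sgn_of_notMem (h : H ∉ S) : sgn S H = -1 := by simp [sgn, h]

open Classical in
theorem sgn_insert_self : sgn (insert H S) H = 1 := by simp [sgn]

open Classical in
theorem sgn_insert_of_mem (hH : H ∉ F) {H' : AffineSubspace ℝ V} (h : H' ∈ F) :
    sgn (insert H S) H' = sgn S H' := by
  have : H' ≠ H := fun e => hH (e ▸ h)
  simp [sgn, this]

open Classical in
theorem mem_cell_insert_neg (hHS : H ∉ S) {x : V} :
    x ∈ cell l c E (insert H F) S ↔ x ∈ cell l c E F S ∧ l H x < c H := by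
  simp only [cell, Set.mem_ofPred_eq, Finset.forall_mem_insert, sgn_of_notMem hHS]
  constructor
  · rintro ⟨h1, h2, h3⟩; exact ⟨⟨h1, h3⟩, by linarith⟩
  · rintro ⟨⟨h1, h3⟩, h2⟩; exact ⟨h1, by linarith, h3⟩

open Classical in
theorem mem_cell_insert_pos (hHF : H ∉ F) {x : V} :
    x ∈ cell l c E (insert H F) (insert H S) ↔ x ∈ cell l c E F S ∧ c H < l H x := by
  simp only [cell, Set.mem_ofPred_eq, Finset.forall_mem_insert, sgn_insert_self]
  have : (∀ a ∈ F, 0 < sgn (insert H S) a * (l a x - c a)) ↔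
      ∀ a ∈ F, 0 < sgn S a * (l a x - c a) :=
    forall₂_congr fun a ha => by rw [sgn_insert_of_mem hHF ha]
  rw [this]
  constructor
  · rintro ⟨h1, h2, h3⟩; exact ⟨⟨h1, h3⟩, by linarith⟩
  · rintro ⟨⟨h1, h3⟩, h2⟩; exact ⟨h1, by linarith, h3⟩

theorem mem_cell_inf (hl : ∀ x, x ∈ H ↔ l H x = c H) {x : V} :
    x ∈ cell l c (E ⊓ H) F S ↔ x ∈ cell l c E F S ∧ l H x = c H := by
  simp only [cell, Set.mem_ofPred_eq, AffineSubspace.mem_inf_iff, hl]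
  tauto

theorem convex_cell : Convex ℝ (cell l c E F S) := by
  intro x hx y hy a b ha hb hab
  refine ⟨E.convex hx.1 hy.1 ha hb hab, fun H hH => ?_⟩
  have h1 := hx.2 H hH
  have h2 := hy.2 H hH
  have e : sgn S H * (l H (a • x + b • y) - c H) =
      a * (sgn S H * (l H x - c H)) + b * (sgn S H * (l H y - c H)) := by
    simp only [map_add, map_smul, smul_eq_mul]
    linear_combination (sgn S H * c H) * hab
  rw [e]
  rcases ha.eq_or_lt with rfl | ha
  · have : b = 1 := by linarith
    subst this; linarith
  · have := mul_pos ha h1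
    have := mul_nonneg hb h2.le
    linarith

theorem exists_mem_cell_eq {x y : V} (hx : x ∈ cell l c E F S) (hy : y ∈ cell l c E F S)
    (h1 : l H x < c H) (h2 : c H < l H y) : ∃ z ∈ cell l c E F S, l H z = c H := by
  obtain ⟨z, hz, e⟩ := convex_cell.isPreconnected.intermediate_value hx hy (f := l H)
    (l H).continuous.continuousOn ⟨h1.le, h2.le⟩
  exact ⟨z, hz, e⟩

theorem eventually_add_smul_mem_cell {z v : V} (hz : z ∈ cell l c E F S) (hv : v ∈ E.direction) :
    ∀ᶠ t : ℝ in nhds 0, z + t • v ∈ cell l c E F S := by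
  have h : ∀ᶠ t : ℝ in nhds 0, ∀ H ∈ F, 0 < sgn S H * (l H (z + t • v) - c H) := by
    rw [Filter.eventually_all_finset]
    intro H hH
    have hc : Continuous fun t : ℝ => sgn S H * (l H (z + t • v) - c H) := by fun_prop
    refine hc.continuousAt.eventually_mem (isOpen_Ioi.mem_nhds ?_)
    simpa using hz.2 H hH
  filter_upwards [h] with t ht
  refine ⟨?_, ht⟩
  rw [add_comm]
  exact AffineSubspace.vadd_mem_of_mem_direction (E.direction.smul_mem t hv) hz.1

/-- The cell is relatively open in `E`, so a short step from `z` along `v` or `-v` stays inside it.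
-/
theorem exists_both_sides {z v : V} (hz : z ∈ cell l c E F S) (hv : v ∈ E.direction)
    (hzH : l H z = c H) (hvH : l H v ≠ 0) :
    (∃ x ∈ cell l c E F S, l H x < c H) ∧ ∃ x ∈ cell l c E F S, c H < l H x := by
  wlog h : 0 < l H v generalizing v
  · refine this (v := -v) (E.direction.neg_mem hv) (by simpa using hvH) ?_
    rw [map_neg]
    have := lt_of_le_of_ne (not_lt.1 h) hvH
    linarith
  obtain ⟨ε, hε, hb⟩ := Metric.eventually_nhds_iff.1 (eventually_add_smul_mem_cell hz hv)
  constructor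
  · refine ⟨_, hb (y := -(ε / 2)) (by simp [abs_of_pos hε, hε]), ?_⟩
    simp only [map_add, map_smul, smul_eq_mul, hzH]
    have := mul_pos (half_pos hε) h
    linarith
  · refine ⟨_, hb (y := ε / 2) (by simp [abs_of_pos hε, hε]), ?_⟩
    simp only [map_add, map_smul, smul_eq_mul, hzH]
    have := mul_pos (half_pos hε) h
    linarith

theorem exists_direction_ne_zero (hl : ∀ x, x ∈ H ↔ l H x = c H) (hE : ¬ E ≤ H) {z : V}
    (hz : z ∈ E) (hzH : l H z = c H) : ∃ v ∈ E.direction, l H v ≠ 0 := by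
  obtain ⟨y, hy, hyH⟩ := SetLike.not_le_iff_exists.1 hE
  refine ⟨y -ᵥ z, AffineSubspace.vsub_mem_direction hy hz, fun h => hyH ((hl y).2 ?_)⟩
  rw [vsub_eq_sub, map_sub] at h
  linarith

theorem mem_direction_iff (hl : ∀ x, x ∈ H ↔ l H x = c H) {z : V} (hz : z ∈ H) (v : V) :
    v ∈ H.direction ↔ l H v = 0 := by
  rw [← AffineSubspace.vadd_mem_iff_mem_direction v hz, hl, vadd_eq_add, map_add, (hl z).1 hz]
  simp

theorem mem_direction_inf_iff (hl : ∀ x, x ∈ H ↔ l H x = c H) {z : V} (hz : z ∈ E)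
    (hzH : l H z = c H) (v : V) :
    v ∈ (E ⊓ H).direction ↔ v ∈ E.direction ∧ l H v = 0 := by
  rw [AffineSubspace.direction_inf_of_mem hz ((hl z).2 hzH), Submodule.mem_inf,
    mem_direction_iff hl ((hl z).2 hzH)]

theorem finrank_direction_inf [FiniteDimensional ℝ V] (hl : ∀ x, x ∈ H ↔ l H x = c H)
    (hE : ¬ E ≤ H) {z : V} (hz : z ∈ E) (hzH : l H z = c H) :
    Module.finrank ℝ (E ⊓ H).direction + 1 = Module.finrank ℝ E.direction := by
  obtain ⟨v, hv, hvH⟩ := exists_direction_ne_zero hl hE hz hzH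
  have hne : (l H).toLinearMap.domRestrict E.direction ≠ 0 := fun h =>
    hvH (by simpa using LinearMap.congr_fun h ⟨v, hv⟩)
  have h1 := Module.Dual.finrank_ker_add_one_of_ne_zero hne
  rw [← h1]
  congr 1
  have : (E ⊓ H).direction =
      (LinearMap.ker ((l H).toLinearMap.domRestrict E.direction)).map E.direction.subtype := by
    ext u
    rw [mem_direction_inf_iff hl hz hzH]
    simp [and_comm]
  rw [this]
  exact (Submodule.equivMapOfInjective _ E.direction.injective_subtype _).finrank_eq.symm

-- The subsets containing `H` contribute the restricted sum with opposite sign. No geometry is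
-- involved, so every weight obeys the recursion.
open Classical in
theorem whitneySum_insert (w : AffineSubspace ℝ V → ℤ) (hH : H ∉ F) :
    whitneySum w E (insert H F) = whitneySum w E F - whitneySum w (E ⊓ H) F := by
  unfold whitneySum
  rw [Finset.sum_powerset_insert hH, sub_eq_add_neg, ← Finset.sum_neg_distrib]
  congr 1
  refine Finset.sum_congr rfl fun B hB => ?_
  have : H ∉ B := fun h => hH (Finset.mem_powerset.1 hB h)
  rw [Finset.card_insert_of_notMem this, Finset.coe_insert, sInf_insert, inf_assoc]
  ring

theorem whitneySum_empty (w : AffineSubspace ℝ V → ℤ) : whitneySum w E ∅ = w E := by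
  simp [whitneySum]

open Classical in
/-- The weight `(-1) ^ dim E` of a nonempty affine subspace. -/
noncomputable def signWeight (E : AffineSubspace ℝ V) : ℤ :=
  if (E : Set V).Nonempty then (-1) ^ Module.finrank ℝ E.direction else 0

open Classical in
/-- The weight `1` of a nonempty affine subspace. -/
noncomputable def unitWeight (E : AffineSubspace ℝ V) : ℤ :=
  if (E : Set V).Nonempty then 1 else 0

theorem whitneySum_of_empty {w : AffineSubspace ℝ V → ℤ} (hw : w ⊥ = 0)
    (hE : ¬ (E : Set V).Nonempty) : whitneySum w E F = 0 := by
  have : E = ⊥ := by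
    rwa [Set.not_nonempty_iff_eq_empty, AffineSubspace.coe_eq_bot_iff] at hE
  subst this
  simp [whitneySum, hw]

/-! ### Counting cells by deletion and restriction -/

open Classical in
/-- The number of nonempty cells. -/
noncomputable def cellCount (l : AffineSubspace ℝ V → V →L[ℝ] ℝ) (c : AffineSubspace ℝ V → ℝ)
    (E : AffineSubspace ℝ V) (F : Finset (AffineSubspace ℝ V)) : ℤ :=
  ∑ S ∈ F.powerset, if (cell l c E F S).Nonempty then 1 else 0

open Classical in
/-- The number of nonempty cells without recession vectors. -/
noncomputable def boundedCellCount (l : AffineSubspace ℝ V → V →L[ℝ] ℝ)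
    (c : AffineSubspace ℝ V → ℝ) (E : AffineSubspace ℝ V) (F : Finset (AffineSubspace ℝ V)) : ℤ :=
  ∑ S ∈ F.powerset, if (cell l c E F S).Nonempty ∧ NoRec l E F S then 1 else 0

theorem cell_eq_empty_of_le (hl : ∀ x, x ∈ H ↔ l H x = c H) (hE : E ≤ H) (hH : H ∈ F) :
    ¬ (cell l c E F S).Nonempty := by
  rintro ⟨x, hx, h⟩
  have := h H hH
  rw [(hl x).1 (hE hx)] at this
  simp at this

/-- The four relevant configurations of a nonempty cell and a hyperplane. -/
theorem cell_trichotomy (hl : ∀ x, x ∈ H ↔ l H x = c H) (hE : ¬ E ≤ H)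
    (h : (cell l c E F S).Nonempty) :
    (((∃ z ∈ cell l c E F S, l H z = c H) ∧ (∃ x ∈ cell l c E F S, l H x < c H) ∧
      ∃ x ∈ cell l c E F S, c H < l H x) ∨
    (∀ x ∈ cell l c E F S, l H x < c H)) ∨ (∀ x ∈ cell l c E F S, c H < l H x) := by
  by_cases h0 : ∃ z ∈ cell l c E F S, l H z = c H
  · obtain ⟨z, hz, hzH⟩ := h0
    obtain ⟨v, hv, hvH⟩ := exists_direction_ne_zero hl hE hz.1 hzH
    exact Or.inl (Or.inl ⟨⟨z, hz, hzH⟩, exists_both_sides hz hv hzH hvH⟩)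
  · obtain ⟨x, hx⟩ := h
    rcases lt_trichotomy (l H x) (c H) with hlt | heq | hgt
    · refine Or.inl (Or.inr fun y hy => ?_)
      by_contra! hle
      rcases hle.eq_or_lt with e | hgt
      · exact h0 ⟨y, hy, e.symm⟩
      · exact h0 (exists_mem_cell_eq hx hy hlt hgt)
    · exact absurd ⟨x, hx, heq⟩ h0
    · refine Or.inr fun y hy => ?_
      by_contra! hle
      rcases hle.eq_or_lt with e | hlt
      · exact h0 ⟨y, hy, e⟩
      · exact h0 (exists_mem_cell_eq hy hx hlt hgt)

-- Cell by cell: if `H` meets the cell, it cuts it into two pieces along one cell of `E ⊓ H`, and `1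
-- + 1 = 1 + 1`; otherwise the cell survives on one side only, and `1 = 1 + 0`.
open Classical in
theorem cellCount_insert (hl : ∀ x, x ∈ H ↔ l H x = c H) (hE : ¬ E ≤ H) (hH : H ∉ F) :
    cellCount l c E (insert H F) = cellCount l c E F + cellCount l c (E ⊓ H) F := by
  unfold cellCount
  rw [Finset.sum_powerset_insert hH, ← Finset.sum_add_distrib, ← Finset.sum_add_distrib]
  refine Finset.sum_congr rfl fun S hS => ?_
  have hHS : H ∉ S := fun h => hH (Finset.mem_powerset.1 hS h)
  simp only [Set.Nonempty, mem_cell_insert_neg hHS, mem_cell_insert_pos hH, mem_cell_inf hl]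
  by_cases h : (cell l c E F S).Nonempty
  · have h' := h
    obtain ⟨x, hx⟩ := h'
    have hex : ∃ x, x ∈ cell l c E F S := h
    rcases cell_trichotomy hl hE h with (⟨h0, h1, h2⟩ | h1) | h1
    · simp [h0, h1, h2, hex]
    · have a0 : ¬ ∃ x, x ∈ cell l c E F S ∧ l H x = c H := fun ⟨y, hy, e⟩ => (h1 y hy).ne e
      have a1 : ∃ x, x ∈ cell l c E F S ∧ l H x < c H := ⟨x, hx, h1 x hx⟩
      have a2 : ¬ ∃ x, x ∈ cell l c E F S ∧ c H < l H x := fun ⟨y, hy, e⟩ => (h1 y hy).not_gt e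
      simp [a0, a1, a2, hex]
    · have a0 : ¬ ∃ x, x ∈ cell l c E F S ∧ l H x = c H := fun ⟨y, hy, e⟩ => (h1 y hy).ne' e
      have a1 : ∃ x, x ∈ cell l c E F S ∧ c H < l H x := ⟨x, hx, h1 x hx⟩
      have a2 : ¬ ∃ x, x ∈ cell l c E F S ∧ l H x < c H := fun ⟨y, hy, e⟩ => (h1 y hy).not_gt e
      simp [a0, a1, a2, hex]
  · have h' : ∀ x, x ∉ cell l c E F S := fun x hx => h ⟨x, hx⟩
    simp [h']

theorem cellCount_eq [FiniteDimensional ℝ V] (F : Finset (AffineSubspace ℝ V))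
    (hl : ∀ H ∈ F, ∀ x, x ∈ H ↔ l H x = c H) (E : AffineSubspace ℝ V) :
    cellCount l c E F = (-1) ^ Module.finrank ℝ E.direction * whitneySum signWeight E F := by
  classical
  induction F using Finset.induction_on generalizing E with
  | empty =>
    by_cases h : (E : Set V).Nonempty
    · rw [whitneySum_empty, signWeight, if_pos h, ← mul_pow]
      have : (cell l c E ∅ ∅).Nonempty := h.mono fun x hx => ⟨hx, by simp⟩
      rw [cellCount, Finset.powerset_empty, Finset.sum_singleton, if_pos this]
      simp
    · have h' : ¬ (cell l c E ∅ ∅).Nonempty := fun ⟨x, hx⟩ => h ⟨x, hx.1⟩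
      simp [whitneySum_empty, cellCount, signWeight, h, h']
  | insert H F hH ih =>
    have hlH := hl H (Finset.mem_insert_self H F)
    have ih := ih fun H' h' => hl H' (Finset.mem_insert_of_mem h')
    rw [whitneySum_insert _ hH]
    by_cases hE : E ≤ H
    -- If `H` contains `E`, no cell avoids `H`, and deletion cancels restriction.
    · rw [inf_eq_left.2 hE, sub_self, mul_zero]
      exact Finset.sum_eq_zero fun S _ =>
        if_neg (cell_eq_empty_of_le hlH hE (Finset.mem_insert_self H F))
    · rw [cellCount_insert hlH hE hH, ih E, ih (E ⊓ H), mul_sub, sub_eq_add_neg]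
      -- The dimension drops by one on `E ⊓ H`, which turns the minus sign of `whitneySum_insert`
      -- into a plus; an empty `E ⊓ H` contributes nothing.
      congr 1
      by_cases hne : ((E ⊓ H : AffineSubspace ℝ V) : Set V).Nonempty
      · obtain ⟨z, hz⟩ := hne
        rw [← finrank_direction_inf hlH hE hz.1 ((hlH z).1 hz.2)]
        ring
      · rw [whitneySum_of_empty (by simp [signWeight]) hne]
        simp

/-! ### Recession cones and bounded cells -/

theorem add_smul_mem_cell {x v : V} (hx : x ∈ cell l c E F S) (hv : v ∈ E.direction)
    (h : ∀ H ∈ F, 0 ≤ sgn S H * l H v) {t : ℝ} (ht : 0 ≤ t) : x + t • v ∈ cell l c E F S := by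
  refine ⟨?_, fun H hH => ?_⟩
  · rw [add_comm]
    exact AffineSubspace.vadd_mem_of_mem_direction (E.direction.smul_mem t hv) hx.1
  · have h1 := hx.2 H hH
    have h2 := mul_nonneg ht (h H hH)
    simp only [map_add, map_smul, smul_eq_mul]
    nlinarith

theorem nonneg_of_forall_add_mul_pos {a b : ℝ} (h : ∀ t : ℝ, 0 ≤ t → 0 < a + t * b) : 0 ≤ b := by
  by_contra! hb
  -- At this `t` the affine function takes the value `a - |a| ≤ 0`.
  have := h (|a| / (-b)) (by have := abs_nonneg a; have : 0 < -b := by linarith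
                             positivity)
  have e : |a| / (-b) * b = -|a| := by
    rw [div_neg, neg_mul, div_mul_cancel₀ _ hb.ne]
  rw [e] at this
  have h2 := le_abs_self a
  linarith

open Classical in
theorem noRec_insert_neg (hHS : H ∉ S) :
    NoRec l E (insert H F) S ↔
      ∀ v ∈ E.direction, (∀ H ∈ F, 0 ≤ sgn S H * l H v) → l H v ≤ 0 → v = 0 := by
  simp only [NoRec, Finset.forall_mem_insert, sgn_of_notMem hHS]
  refine forall₂_congr fun v _ => ⟨fun h h1 h2 => h ⟨by linarith, h1⟩,
    fun h h1 => h h1.2 (by linarith)⟩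

open Classical in
theorem noRec_insert_pos (hHF : H ∉ F) :
    NoRec l E (insert H F) (insert H S) ↔
      ∀ v ∈ E.direction, (∀ H ∈ F, 0 ≤ sgn S H * l H v) → 0 ≤ l H v → v = 0 := by
  simp only [NoRec, Finset.forall_mem_insert, sgn_insert_self, one_mul]
  refine forall₂_congr fun v _ => ?_
  have : (∀ a ∈ F, 0 ≤ sgn (insert H S) a * l a v) ↔ ∀ a ∈ F, 0 ≤ sgn S a * l a v :=
    forall₂_congr fun a ha => by rw [sgn_insert_of_mem hHF ha]
  rw [this]
  tauto

theorem noRec_inf (hl : ∀ x, x ∈ H ↔ l H x = c H) {z : V} (hz : z ∈ E) (hzH : l H z = c H) :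
    NoRec l (E ⊓ H) F S ↔
      ∀ v ∈ E.direction, (∀ H ∈ F, 0 ≤ sgn S H * l H v) → l H v = 0 → v = 0 := by
  simp only [NoRec, mem_direction_inf_iff hl hz hzH]
  exact forall_congr' fun v => by tauto

/-- If the recession cone meets the hyperplane `l H = 0` only in `0`, then it lies on one side. -/
theorem one_sided_of_inter_eq_zero (hs : Separates l E F)
    (h0 : ∀ v ∈ E.direction, (∀ H ∈ F, 0 ≤ sgn S H * l H v) → l H v = 0 → v = 0) :
    (∀ v ∈ E.direction, (∀ H ∈ F, 0 ≤ sgn S H * l H v) → l H v ≤ 0 → v = 0) ∨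
    (∀ v ∈ E.direction, (∀ H ∈ F, 0 ≤ sgn S H * l H v) → 0 ≤ l H v → v = 0) := by
  by_contra! hcon
  obtain ⟨⟨u, hu, hur, huH, hu0⟩, v, hv, hvr, hvH, hv0⟩ := hcon
  have huH : l H u < 0 := lt_of_le_of_ne huH fun e => hu0 (h0 u hu hur e)
  have hvH : 0 < l H v := lt_of_le_of_ne hvH fun e => hv0 (h0 v hv hvr e.symm)
  -- The positive combination of `u` and `v` killed by `l H`; it lies in the cone by convexity,
  -- hence is zero.
  have hw := h0 (l H v • u + (-l H u) • v)
    (E.direction.add_mem (E.direction.smul_mem _ hu) (E.direction.smul_mem _ hv))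
    (fun H' hH' => by
      have h1 := mul_nonneg hvH.le (hur H' hH')
      have h2 := mul_nonneg (neg_nonneg.2 huH.le) (hvr H' hH')
      simp only [map_add, map_smul, smul_eq_mul]
      linarith) (by simp only [map_add, map_smul, smul_eq_mul]; ring)
  refine hu0 (hs u hu fun H' hH' => ?_)
  have h1 := mul_nonneg hvH.le (hur H' hH')
  have h2 := mul_nonneg (neg_nonneg.2 huH.le) (hvr H' hH')
  have h3 := congrArg (l H') hw
  simp only [map_add, map_smul, smul_eq_mul, map_zero] at h3
  -- Two nonnegative terms with sum zero both vanish, so every `l H'` kills `u`.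
  have h4 : l H v * (sgn S H' * l H' u) + -l H u * (sgn S H' * l H' v) = 0 := by
    linear_combination sgn S H' * h3
  have h5 : l H v * (sgn S H' * l H' u) = 0 := by linarith
  have h6 : sgn S H' ≠ 0 := by rcases sgn_cases S H' with e | e <;> simp [e]
  simpa [hvH.ne', h6] using h5

-- When `H` cuts a cell, the recession cones of the two pieces and of the slice are the parts of the
-- old cone with `l H ≤ 0`, `0 ≤ l H` and `l H = 0`. When `H` misses the cell, the cone cannot cross
-- `l H = 0` to the wrong side, so nothing changes.
open Classical in
theorem boundedCellCount_insert (hl : ∀ x, x ∈ H ↔ l H x = c H) (hE : ¬ E ≤ H) (hH : H ∉ F)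
    (hs : Separates l E F) :
    boundedCellCount l c E (insert H F) =
      boundedCellCount l c E F + boundedCellCount l c (E ⊓ H) F := by
  unfold boundedCellCount
  rw [Finset.sum_powerset_insert hH, ← Finset.sum_add_distrib, ← Finset.sum_add_distrib]
  refine Finset.sum_congr rfl fun S hS => ?_
  have hHS : H ∉ S := fun h => hH (Finset.mem_powerset.1 hS h)
  rw [noRec_insert_neg hHS, noRec_insert_pos hH]
  simp only [Set.Nonempty, mem_cell_insert_neg hHS, mem_cell_insert_pos hH, mem_cell_inf hl]
  by_cases h : (cell l c E F S).Nonempty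
  · have h' := h
    obtain ⟨x, hx⟩ := h'
    have hex : ∃ x, x ∈ cell l c E F S := h
    rcases cell_trichotomy hl hE h with (⟨h0, h1, h2⟩ | h1) | h1
    · have h0' := h0
      obtain ⟨z, hz, hzH⟩ := h0'
      rw [noRec_inf hl hz.1 hzH]
      simp only [h0, h1, h2, hex, true_and]
      -- A zero cone gives `1 + 1 = 1 + 1`. A nonzero cone meeting one closed half-space only in `0`
      -- gives `1 = 0 + 1`, the slice alone being counted on the right. If neither half is trivial,
      -- separation prevents the slice from being trivial, and all terms vanish.
      by_cases hn : ∀ v ∈ E.direction, (∀ H ∈ F, 0 ≤ sgn S H * l H v) → l H v ≤ 0 → v = 0 <;>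
        by_cases hp : ∀ v ∈ E.direction, (∀ H ∈ F, 0 ≤ sgn S H * l H v) → 0 ≤ l H v → v = 0
      · have e1 : NoRec l E F S := fun v hv hr => (le_total (l H v) 0).elim (hn v hv hr) (hp v hv hr)
        rw [if_pos hn, if_pos hp, if_pos e1, if_pos fun v hv hr he => e1 v hv hr]
      · have e1 : ¬ NoRec l E F S := fun e => hp fun v hv hr _ => e v hv hr
        rw [if_pos hn, if_neg hp, if_neg e1, if_pos fun v hv hr he => hn v hv hr he.le]
        rfl
      · have e1 : ¬ NoRec l E F S := fun e => hn fun v hv hr _ => e v hv hr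
        rw [if_neg hn, if_pos hp, if_neg e1, if_pos fun v hv hr he => hp v hv hr he.ge]
      · have e1 : ¬ NoRec l E F S := fun e => hn fun v hv hr _ => e v hv hr
        rw [if_neg hn, if_neg hp, if_neg e1,
          if_neg fun e => (one_sided_of_inter_eq_zero hs e).elim hn hp]
    · have a0 : ¬ ∃ x, x ∈ cell l c E F S ∧ l H x = c H := fun ⟨y, hy, e⟩ => (h1 y hy).ne e
      have a1 : ∃ x, x ∈ cell l c E F S ∧ l H x < c H := ⟨x, hx, h1 x hx⟩
      have a2 : ¬ ∃ x, x ∈ cell l c E F S ∧ c H < l H x := fun ⟨y, hy, e⟩ => (h1 y hy).not_gt e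
      have e : (∀ v ∈ E.direction, (∀ H ∈ F, 0 ≤ sgn S H * l H v) → l H v ≤ 0 → v = 0) ↔
          NoRec l E F S := by
        -- The ray from `x` along a recession vector stays in the cell, hence on one side of `H`,
        -- which fixes the sign of `l H v`.
        refine forall₃_congr fun v hv hr => ⟨fun h => h ?_, fun h _ => h⟩
        have := nonneg_of_forall_add_mul_pos (a := c H - l H x) (b := - l H v) fun t ht => by
          have := h1 _ (add_smul_mem_cell hx hv hr ht)
          simp only [map_add, map_smul, smul_eq_mul] at this
          linarith
        linarith
      simp only [a0, a1, a2, hex, e, true_and, false_and, if_false]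
    · have a0 : ¬ ∃ x, x ∈ cell l c E F S ∧ l H x = c H := fun ⟨y, hy, e⟩ => (h1 y hy).ne' e
      have a1 : ∃ x, x ∈ cell l c E F S ∧ c H < l H x := ⟨x, hx, h1 x hx⟩
      have a2 : ¬ ∃ x, x ∈ cell l c E F S ∧ l H x < c H := fun ⟨y, hy, e⟩ => (h1 y hy).not_gt e
      have e : (∀ v ∈ E.direction, (∀ H ∈ F, 0 ≤ sgn S H * l H v) → 0 ≤ l H v → v = 0) ↔
          NoRec l E F S := by
        refine forall₃_congr fun v hv hr => ⟨fun h => h ?_, fun h _ => h⟩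
        refine nonneg_of_forall_add_mul_pos (a := l H x - c H) (b := l H v) fun t ht => ?_
        have := h1 _ (add_smul_mem_cell hx hv hr ht)
        simp only [map_add, map_smul, smul_eq_mul] at this
        linarith
      simp only [a0, a1, a2, hex, e, true_and, false_and, if_false, zero_add, add_zero]
  · have h' : ∀ x, x ∉ cell l c E F S := fun x hx => h ⟨x, hx⟩
    simp [h']

-- A nonzero direction killed by all forms of `F`, taken with the sign that suits `H`, is a
-- recession vector of every cell.
open Classical in
theorem boundedCellCount_insert_eq_zero (hs' : ¬ Separates l E F) :
    boundedCellCount l c E (insert H F) = 0 := by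
  simp only [Separates, not_forall] at hs'
  obtain ⟨v, hv, hvF, hv0⟩ := hs'
  refine Finset.sum_eq_zero fun S _ => if_neg fun ⟨_, hr⟩ => ?_
  rcases le_total 0 (sgn S H * l H v) with h | h
  · exact hv0 (hr v hv ((Finset.forall_mem_insert _ _ _).2
      ⟨h, fun H' h' => by rw [hvF H' h', mul_zero]⟩))
  · refine hv0 (neg_eq_zero.1 (hr (-v) (E.direction.neg_mem hv) ((Finset.forall_mem_insert _ _ _).2
      ⟨by rw [map_neg]; linarith, fun H' h' => by rw [map_neg, hvF H' h', neg_zero, mul_zero]⟩)))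

-- Some direction `v` is killed by all forms of `F` but not by `l H`. Sliding along `v` reaches `H`
-- without leaving the other hyperplanes, so intersecting with `H` never empties a flat and the
-- terms for `B` and `insert H B` cancel.
open Classical in
theorem whitneySum_unitWeight_insert_eq_zero (hl : ∀ H' ∈ insert H F, ∀ x, x ∈ H' ↔ l H' x = c H')
    (hH : H ∉ F) (hs : Separates l E (insert H F)) (hs' : ¬ Separates l E F) :
    whitneySum unitWeight E (insert H F) = 0 := by
  simp only [Separates, not_forall] at hs'
  obtain ⟨v, hv, hvF, hv0⟩ := hs'
  have hvH : l H v ≠ 0 := fun e => hv0 (hs v hv ((Finset.forall_mem_insert _ _ _).2 ⟨e, hvF⟩))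
  rw [whitneySum_insert _ hH, sub_eq_zero]
  refine Finset.sum_congr rfl fun B hB => ?_
  have hiff : ((E ⊓ sInf (B : Set (AffineSubspace ℝ V)) : AffineSubspace ℝ V) : Set V).Nonempty ↔
      ((E ⊓ H ⊓ sInf (B : Set (AffineSubspace ℝ V)) : AffineSubspace ℝ V) : Set V).Nonempty := by
    constructor
    · rintro ⟨x, hx, hxB⟩
      -- The multiple of `v` that brings the value of `l H` to `c H`.
      refine ⟨((c H - l H x) / l H v) • v +ᵥ x, ⟨?_, ?_⟩, ?_⟩
      · exact AffineSubspace.vadd_mem_of_mem_direction (E.direction.smul_mem _ hv) hx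
      · refine (hl H (Finset.mem_insert_self H F) _).2 ?_
        simp only [vadd_eq_add, map_add, map_smul, smul_eq_mul]
        field_simp
        ring_nf
      · refine (AffineSubspace.mem_sInf_iff _ _).2 fun H' hH' => ?_
        have hF' := Finset.mem_powerset.1 hB hH'
        have hl' := hl H' (Finset.mem_insert_of_mem hF')
        rw [hl']
        simp only [vadd_eq_add, map_add, map_smul, smul_eq_mul, hvF H' hF', mul_zero, zero_add]
        exact (hl' x).1 ((AffineSubspace.mem_sInf_iff _ _).1 hxB H' hH')
    · rintro ⟨x, hx, hxB⟩
      exact ⟨x, hx.1, hxB⟩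
  simp only [unitWeight, hiff]

theorem boundedCellCount_eq [FiniteDimensional ℝ V] (F : Finset (AffineSubspace ℝ V))
    (hl : ∀ H ∈ F, ∀ x, x ∈ H ↔ l H x = c H) (E : AffineSubspace ℝ V) (hs : Separates l E F) :
    boundedCellCount l c E F =
      (-1) ^ Module.finrank ℝ E.direction * whitneySum unitWeight E F := by
  classical
  induction F using Finset.induction_on generalizing E with
  | empty =>
    -- With no forms, separation forces `E` to be a point or empty.
    have hdir : E.direction = ⊥ := (Submodule.eq_bot_iff _).2 fun v hv => hs v hv (by simp)
    have hr : NoRec l E ∅ ∅ := fun v hv _ => hs v hv (by simp)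
    by_cases h : (E : Set V).Nonempty
    · have : (cell l c E ∅ ∅).Nonempty := h.mono fun x hx => ⟨hx, by simp⟩
      rw [whitneySum_empty, unitWeight, if_pos h, hdir, finrank_bot, boundedCellCount,
        Finset.powerset_empty, Finset.sum_singleton, if_pos ⟨this, hr⟩]
      simp
    · have h' : ¬ (cell l c E ∅ ∅).Nonempty := fun ⟨x, hx⟩ => h ⟨x, hx.1⟩
      simp [whitneySum_empty, boundedCellCount, unitWeight, h, h']
  | insert H F hH ih =>
    have hlH := hl H (Finset.mem_insert_self H F)
    have ih := ih fun H' h' => hl H' (Finset.mem_insert_of_mem h')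
    by_cases hs' : Separates l E F
    · rw [whitneySum_insert _ hH]
      by_cases hE : E ≤ H
      · rw [inf_eq_left.2 hE, sub_self, mul_zero]
        exact Finset.sum_eq_zero fun S _ =>
          if_neg fun h => cell_eq_empty_of_le hlH hE (Finset.mem_insert_self H F) h.1
      · have hs2 : Separates l (E ⊓ H) F := fun v hv =>
          hs' v (AffineSubspace.direction_le inf_le_left hv)
        rw [boundedCellCount_insert hlH hE hH hs', ih E hs', ih (E ⊓ H) hs2, mul_sub,
          sub_eq_add_neg]
        congr 1
        by_cases hne : ((E ⊓ H : AffineSubspace ℝ V) : Set V).Nonempty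
        · obtain ⟨z, hz⟩ := hne
          rw [← finrank_direction_inf hlH hE hz.1 ((hlH z).1 hz.2)]
          ring
        · rw [whitneySum_of_empty (by simp [unitWeight]) hne]
          simp
    · rw [boundedCellCount_insert_eq_zero hs',
        whitneySum_unitWeight_insert_eq_zero hl hH hs hs', mul_zero]

end Cells
-- Chains, Hall's theorem and Whitney numbers
section Chains

open Classical in
/-- The chains contained in a finite set. -/
noncomputable def chainsIn {P : Type*} [PartialOrder P] (D : Finset P) : Finset (Finset P) :=
  D.powerset.filter fun C => IsChain (· ≤ ·) (C : Set P)

open Classical in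
/-- Nonempty chains are classified by their largest element. -/
theorem sum_chainsIn {P : Type*} [PartialOrder P] (D : Finset P) (φ : Finset P → ℤ) :
    ∑ C ∈ chainsIn D, φ C =
      φ ∅ + ∑ Y ∈ D, ∑ C ∈ chainsIn (D.filter (· < Y)), φ (insert Y C) := by
  have h0 : ∅ ∈ chainsIn D := by simp [chainsIn]
  rw [← Finset.add_sum_erase _ _ h0, Finset.sum_sigma']
  congr 1
  symm
  refine Finset.sum_bij (fun p _ => insert p.1 p.2) ?_ ?_ ?_ fun _ _ => rfl
  · rintro ⟨Y, C⟩ h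
    simp only [chainsIn, Finset.mem_sigma, Finset.mem_filter, Finset.mem_powerset,
      Finset.subset_iff] at h
    obtain ⟨hY, hC, hch⟩ := h
    simp only [chainsIn, Finset.mem_erase, Finset.mem_filter, Finset.mem_powerset]
    refine ⟨Finset.insert_ne_empty _ _, Finset.insert_subset hY fun Z hZ => (hC hZ).1, ?_⟩
    rw [Finset.coe_insert]
    exact hch.insert fun Z hZ _ => Or.inr (hC hZ).2.le
  · rintro ⟨Y, C⟩ h ⟨Y', C'⟩ h' e
    simp only [chainsIn, Finset.mem_sigma, Finset.mem_filter, Finset.mem_powerset,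
      Finset.subset_iff] at h h'
    dsimp only at e
    have hle : Y ≤ Y' := by
      have : Y ∈ insert Y' C' := e ▸ Finset.mem_insert_self Y C
      rcases Finset.mem_insert.1 this with h1 | h1
      · exact h1.le
      · exact (h'.2.1 h1).2.le
    have hle' : Y' ≤ Y := by
      have : Y' ∈ insert Y C := e ▸ Finset.mem_insert_self Y' C'
      rcases Finset.mem_insert.1 this with h1 | h1
      · exact h1.le
      · exact (h.2.1 h1).2.le
    obtain rfl := le_antisymm hle hle'
    have n1 : Y ∉ C := fun hm => (h.2.1 hm).2.ne rfl
    have n2 : Y ∉ C' := fun hm => (h'.2.1 hm).2.ne rfl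
    rw [← Finset.erase_insert n1, e, Finset.erase_insert n2]
  · intro C hC
    simp only [chainsIn, Finset.mem_erase, Finset.mem_filter, Finset.mem_powerset] at hC
    obtain ⟨hne, hD, hch⟩ := hC
    obtain ⟨Y, hY⟩ := C.exists_maximal (Finset.nonempty_iff_ne_empty.2 hne)
    refine ⟨⟨Y, C.erase Y⟩, ?_, Finset.insert_erase hY.1⟩
    simp only [chainsIn, Finset.mem_sigma, Finset.mem_filter, Finset.mem_powerset]
    refine ⟨hD hY.1, fun Z hZ => ?_, hch.mono (by simp)⟩
    obtain ⟨hZY, hZ⟩ := Finset.mem_erase.1 hZ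
    refine Finset.mem_filter.2 ⟨hD hZ, lt_of_le_of_ne ?_ hZY⟩
    rcases hch.total hZ hY.1 with h | h
    · exact h
    · exact hY.2 hZ h

open Classical in
/-- Philip Hall's theorem: alternating sums over chains are sums against the Möbius function. -/
theorem sum_chainsIn_eq_sum_moebius {P : Type*} [PartialOrder P] [Fintype P] [OrderBot P]
    {ρ : P → ℕ} (hρ : Monotone ρ) (hρ0 : ρ ⊥ = 0) {m : P → ℤ}
    (hm : ∀ X, ∑ Y ∈ Finset.univ.filter (· ≤ X), m Y = if X = ⊥ then 1 else 0) (g : ℕ → ℤ) :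
    ∑ C ∈ chainsIn (Finset.univ.filter fun X : P => X ≠ ⊥), (-1) ^ C.card * g (C.sup ρ) =
      ∑ X, m X * g (ρ X) := by
  have hm0 : m ⊥ = 1 := by
    have := hm ⊥
    rw [Finset.sum_eq_single ⊥] at this
    · simpa using this
    · exact fun Y hY h => absurd (le_bot_iff.1 (Finset.mem_filter.1 hY).2) h
    · simp
  set D : Finset P := Finset.univ.filter fun X : P => X ≠ ⊥ with hD
  -- Classifying the chains strictly between `⊥` and `X` by their top element yields the recursion
  -- that `hm` imposes on `m`.
  have key : ∀ X : P, X ≠ ⊥ →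
      ∑ C ∈ chainsIn (D.filter (· < X)), (-1 : ℤ) ^ C.card = - m X := by
    intro X
    induction X using WellFoundedLT.induction with
    | ind X ih =>
      intro hX
      rw [sum_chainsIn]
      have e : ∀ Y ∈ D.filter (· < X),
          ∑ C ∈ chainsIn ((D.filter (· < X)).filter (· < Y)), (-1 : ℤ) ^ (insert Y C).card = m Y := by
        intro Y hY
        obtain ⟨hYD, hYX⟩ := Finset.mem_filter.1 hY
        have e1 : (D.filter (· < X)).filter (· < Y) = D.filter (· < Y) := by
          ext Z
          simp only [Finset.mem_filter]
          exact ⟨fun h => ⟨h.1.1, h.2⟩, fun h => ⟨⟨h.1, h.2.trans hYX⟩, h.2⟩⟩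
        rw [e1, ← neg_neg (m Y), ← ih Y hYX (Finset.mem_filter.1 hYD).2, ← Finset.sum_neg_distrib]
        refine Finset.sum_congr rfl fun C hC => ?_
        have : Y ∉ C := fun h => by
          have := Finset.mem_powerset.1 (Finset.mem_filter.1 hC).1 h
          exact (Finset.mem_filter.1 this).2.ne rfl
        rw [Finset.card_insert_of_notMem this, pow_succ]
        ring
      rw [Finset.sum_congr rfl e]
      have h1 := hm X
      rw [if_neg hX] at h1
      have e2 : Finset.univ.filter (· ≤ X) = insert X (insert ⊥ (D.filter (· < X))) := by
        ext Z
        simp only [hD, Finset.mem_filter, Finset.mem_univ, true_and, Finset.mem_insert]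
        constructor
        · intro h
          rcases h.eq_or_lt with h | h
          · exact Or.inl h
          · by_cases hZ : Z = ⊥
            · exact Or.inr (Or.inl hZ)
            · exact Or.inr (Or.inr ⟨hZ, h⟩)
        · rintro (rfl | rfl | h)
          · exact le_rfl
          · exact bot_le
          · exact h.2.le
      rw [e2, Finset.sum_insert (by simp [hX]), Finset.sum_insert (by simp [hD]), hm0] at h1
      simp only [Finset.card_empty, pow_zero]
      linarith
  rw [sum_chainsIn]
  have e3 : (Finset.univ : Finset P) = insert ⊥ D := by
    ext Z
    simpa [hD] using Classical.em (Z = ⊥)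
  -- The empty chain, whose `sup` is `0`, accounts for the term of `⊥`.
  rw [e3, Finset.sum_insert (by simp [hD]), hm0, hρ0]
  simp only [Finset.card_empty, pow_zero, Finset.sup_empty, bot_eq_zero]
  congr 1
  refine Finset.sum_congr rfl fun Y hY => ?_
  rw [← neg_neg (m Y), ← key Y (Finset.mem_filter.1 hY).2, ← Finset.sum_neg_distrib, Finset.sum_mul]
  refine Finset.sum_congr rfl fun C hC => ?_
  have hC' := Finset.mem_powerset.1 (Finset.mem_filter.1 hC).1
  have : Y ∉ C := fun h => (Finset.mem_filter.1 (hC' h)).2.ne rfl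
  have hsup : (insert Y C).sup ρ = ρ Y := by
    rw [Finset.sup_insert, sup_eq_left]
    exact Finset.sup_le fun Z hZ => hρ (Finset.mem_filter.1 (hC' hZ)).2.le
  rw [Finset.card_insert_of_notMem this, pow_succ, hsup]
  ring

variable {P : Type*} [PartialOrder P] [GradeMinOrder ℕ P]

theorem IsChain.grade_injOn {C : Set P} (hC : IsChain (· ≤ ·) C) :
    Set.InjOn (grade ℕ : P → ℕ) C := by
  intro x hx y hy e
  rcases hC.total hx hy with h | h
  · exact h.eq_of_not_lt fun hlt => (grade_strictMono hlt).ne e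
  · exact (h.eq_of_not_lt fun hlt => (grade_strictMono hlt).ne' e).symm

open Classical in
/-- The Whitney number `W_I` counts the chains with set of ranks `I`. -/
theorem whitney_eq_card_chains [Fintype P] (I : Finset ℕ) :
    whitney P I = ((chainsIn (Finset.univ : Finset P)).filter
      fun C => C.image (grade ℕ) = I).card := by
  unfold whitney whitneyTuple
  set i := I.orderEmbOfFin rfl with hi
  have hrange : ∀ a, a ∈ I ↔ ∃ j, i j = a := fun a => by
    have := Finset.range_orderEmbOfFin I rfl
    rw [← Set.mem_range, this, Finset.mem_coe]
  refine Eq.trans (Nat.card_congr ?_) (Nat.card_eq_finsetCard _)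
  refine (Equiv.ofBijective (fun X => ⟨Finset.univ.image X.1, ?_⟩) ⟨?_, ?_⟩)
  · obtain ⟨X, hX, hr⟩ := X
    simp only [chainsIn, Finset.mem_filter, Finset.mem_powerset, Finset.subset_univ, true_and]
    constructor
    · rw [Finset.coe_image, Finset.coe_univ, Set.image_univ]
      rintro _ ⟨a, rfl⟩ _ ⟨b, rfl⟩ _
      exact (le_total a b).imp (fun h => hX h) fun h => hX h
    · ext a
      simp [hrange, hr]
  · rintro ⟨X, hX, hr⟩ ⟨X', hX', hr'⟩ h
    have h : Finset.univ.image X = Finset.univ.image X' := congrArg Subtype.val h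
    ext j
    have : X j ∈ Finset.univ.image X' := h ▸ Finset.mem_image_of_mem X (Finset.mem_univ j)
    obtain ⟨k, _, hk⟩ := Finset.mem_image.1 this
    have e : i k = i j := by rw [← hr' k, ← hr j, hk]
    change X j = X' j
    rw [← hk, i.injective e]
  · rintro ⟨C, hC⟩
    simp only [chainsIn, Finset.mem_filter, Finset.mem_powerset, Finset.subset_univ,
      true_and] at hC
    obtain ⟨hch, him⟩ := hC
    have : ∀ j, ∃ x ∈ C, grade ℕ x = i j := fun j => by
      have : i j ∈ C.image (grade ℕ) := him ▸ (hrange _).2 ⟨j, rfl⟩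
      exact Finset.mem_image.1 this
    choose X hXC hXr using this
    refine ⟨⟨X, fun a b hab => ?_, hXr⟩, Subtype.ext (Finset.Subset.antisymm ?_ ?_)⟩
    · rcases hch.total (hXC a) (hXC b) with h | h
      · exact h
      · have := grade_strictMono.monotone (α := P) (β := ℕ) h
        rw [hXr, hXr] at this
        rw [le_antisymm hab (i.le_iff_le.1 this)]
    · exact Finset.image_subset_iff.2 fun j _ => hXC j
    · intro y hy
      obtain ⟨j, hj⟩ := (hrange _).1 (him ▸ Finset.mem_image_of_mem (grade ℕ) hy)
      refine Finset.mem_image.2 ⟨j, Finset.mem_univ j, ?_⟩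
      exact hch.grade_injOn (hXC j) hy (by rw [hXr, hj])

-- The fibre over `I` consists of the chains with rank set `I`. The rank is injective on a chain, so
-- cardinality and top rank depend on `I` alone; `I` avoids `0`, so no element of rank `0` occurs.
open Classical in
theorem sum_whitney_eq_sum_chains [Fintype P] {n : ℕ} (hn : ∀ X : P, grade ℕ X ≤ n)
    (g : ℕ → ℤ) :
    ∑ I ∈ (Finset.Icc 1 n).powerset, (-1 : ℤ) ^ I.card * g (I.sup id) * (whitney P I : ℤ) =
      ∑ C ∈ chainsIn (Finset.univ.filter fun X : P => grade ℕ X ≠ 0),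
        (-1) ^ C.card * g (C.sup (grade ℕ)) := by
  rw [← Finset.sum_fiberwise_of_maps_to (s := chainsIn _) (t := (Finset.Icc 1 n).powerset)
    (g := fun C => C.image (grade ℕ))]
  · refine Finset.sum_congr rfl fun I hI => ?_
    have e : (chainsIn (Finset.univ.filter fun X : P => grade ℕ X ≠ 0)).filter
        (fun C => C.image (grade ℕ) = I) =
        (chainsIn (Finset.univ : Finset P)).filter fun C => C.image (grade ℕ) = I := by
      ext C
      simp only [chainsIn, Finset.mem_filter, Finset.mem_powerset, Finset.subset_univ, true_and]
      constructor
      · exact fun h => ⟨h.1.2, h.2⟩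
      · refine fun h => ⟨⟨fun x hx => ?_, h.1⟩, h.2⟩
        have := Finset.mem_Icc.1 (Finset.mem_powerset.1 hI (h.2 ▸ Finset.mem_image_of_mem _ hx))
        simp only [Finset.mem_filter, Finset.mem_univ, true_and]
        omega
    rw [e, whitney_eq_card_chains, mul_comm, ← nsmul_eq_mul, ← Finset.sum_const]
    refine Finset.sum_congr rfl fun C hC => ?_
    obtain ⟨hC', rfl⟩ := Finset.mem_filter.1 hC
    rw [Finset.card_image_of_injOn (IsChain.grade_injOn (Finset.mem_filter.1 hC').2), Finset.sup_image]
    rfl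
  · intro C hC
    refine Finset.mem_powerset.2 (Finset.image_subset_iff.2 fun x hx => Finset.mem_Icc.2 ⟨?_, hn x⟩)
    have := Finset.mem_powerset.1 (Finset.mem_filter.1 hC).1 hx
    exact Nat.one_le_iff_ne_zero.2 (Finset.mem_filter.1 this).2

end Chains
-- Regions as sign cells
namespace HyperplaneArrangement

open Cells

variable {V : Type*} [NormedAddCommGroup V] [InnerProductSpace ℝ V]

/-- The quotient by the direction is a line; a coordinate on it is the required form. -/
theorem exists_equation [FiniteDimensional ℝ V] (H : AffineSubspace ℝ V)
    (hne : (H : Set V).Nonempty) (h1 : Module.finrank ℝ (V ⧸ H.direction) = 1) :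
    ∃ (l : V →L[ℝ] ℝ) (c : ℝ), ∀ x, x ∈ H ↔ l x = c := by
  obtain ⟨p, hp⟩ := hne
  let e : (V ⧸ H.direction) ≃ₗ[ℝ] ℝ := LinearEquiv.ofFinrankEq _ _ (by simp [h1])
  let l : V →ₗ[ℝ] ℝ := e.toLinearMap ∘ₗ H.direction.mkQ
  refine ⟨LinearMap.toContinuousLinearMap l, l p, fun x => ?_⟩
  rw [← AffineSubspace.vsub_right_mem_direction_iff_mem hp, vsub_eq_sub]
  have : x - p ∈ H.direction ↔ l (x - p) = 0 := by
    rw [← Submodule.Quotient.mk_eq_zero, ← e.map_eq_zero_iff]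
    rfl
  rw [this, map_sub, sub_eq_zero]
  rfl

variable {A : HyperplaneArrangement V} {l : AffineSubspace ℝ V → V →L[ℝ] ℝ}
  {c : AffineSubspace ℝ V → ℝ} {F : Finset (AffineSubspace ℝ V)}

theorem cell_subset_complement (hF : (F : Set (AffineSubspace ℝ V)) = A.hyperplanes)
    (hl : ∀ H ∈ F, ∀ x, x ∈ H ↔ l H x = c H) (S : Finset (AffineSubspace ℝ V)) :
    cell l c ⊤ F S ⊆ A.complement := by
  intro x hx H hH hxH
  have hH : H ∈ F := by rwa [← hF] at hH
  have := hx.2 H hH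
  rw [(hl H hH x).1 hxH] at this
  simp at this

/-- Cells are convex, hence connected; a connected set leaving the cell would meet a hyperplane by
the intermediate value theorem. -/
theorem connectedComponentIn_eq_cell (hF : (F : Set (AffineSubspace ℝ V)) = A.hyperplanes)
    (hl : ∀ H ∈ F, ∀ x, x ∈ H ↔ l H x = c H) {S : Finset (AffineSubspace ℝ V)} {x : V}
    (hx : x ∈ cell l c ⊤ F S) : connectedComponentIn A.complement x = cell l c ⊤ F S := by
  refine Set.Subset.antisymm (fun y hy => ⟨trivial, fun H hH => ?_⟩)
    (convex_cell.isPreconnected.subset_connectedComponentIn hx (cell_subset_complement hF hl S))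
  by_contra! hle
  have hxc := cell_subset_complement hF hl S hx
  have hcont : Continuous fun z => sgn S H * (l H z - c H) := by fun_prop
  obtain ⟨z, hz, hz0⟩ := isPreconnected_connectedComponentIn.intermediate_value hy
    (mem_connectedComponentIn hxc) hcont.continuousOn ⟨hle, (hx.2 H hH).le⟩
  have h6 : sgn S H ≠ 0 := by rcases sgn_cases S H with e | e <;> simp [e]
  have hzH : l H z = c H := by
    have := (mul_eq_zero.1 hz0).resolve_left h6
    linarith
  exact connectedComponentIn_subset _ _ hz H (hF ▸ hH) ((hl H hH z).2 hzH)

open Classical in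
theorem exists_mem_cell (hF : (F : Set (AffineSubspace ℝ V)) = A.hyperplanes)
    (hl : ∀ H ∈ F, ∀ x, x ∈ H ↔ l H x = c H) {x : V} (hx : x ∈ A.complement) :
    ∃ S ∈ F.powerset, x ∈ cell l c ⊤ F S := by
  refine ⟨F.filter fun H => c H < l H x, Finset.mem_powerset.2 (Finset.filter_subset _ _),
    trivial, fun H hH => ?_⟩
  have hne : l H x ≠ c H := fun e => hx H (hF ▸ hH) ((hl H hH x).2 e)
  unfold sgn
  simp only [Finset.mem_filter, hH, true_and]
  split_ifs with h
  · linarith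
  · have := lt_of_le_of_ne (not_lt.1 h) hne
    linarith

open Classical in
theorem regions_eq_image (hF : (F : Set (AffineSubspace ℝ V)) = A.hyperplanes)
    (hl : ∀ H ∈ F, ∀ x, x ∈ H ↔ l H x = c H) :
    A.regions = (fun S => cell l c ⊤ F S) ''
      (F.powerset.filter fun S => (cell l c ⊤ F S).Nonempty : Finset _) := by
  ext R
  simp only [regions, Set.mem_ofPred_eq, Set.mem_image, Finset.mem_coe, Finset.mem_filter]
  constructor
  · rintro ⟨x, hx, rfl⟩
    obtain ⟨S, hS, hxS⟩ := exists_mem_cell hF hl hx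
    exact ⟨S, ⟨hS, x, hxS⟩, (connectedComponentIn_eq_cell hF hl hxS).symm⟩
  · rintro ⟨S, ⟨hS, x, hx⟩, rfl⟩
    exact ⟨x, cell_subset_complement hF hl S hx, (connectedComponentIn_eq_cell hF hl hx).symm⟩

theorem cell_injOn {S T : Finset (AffineSubspace ℝ V)} (hS : S ⊆ F) (hT : T ⊆ F)
    (hne : (cell l c ⊤ F S).Nonempty) (h : cell l c ⊤ F S = cell l c ⊤ F T) : S = T := by
  obtain ⟨x, hx⟩ := hne
  have hx' := h ▸ hx
  have key : ∀ H ∈ F, (H ∈ S ↔ H ∈ T) := fun H hH => by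
    have h1 := hx.2 H hH
    have h2 := hx'.2 H hH
    unfold sgn at h1 h2
    by_cases hS : H ∈ S <;> by_cases hT : H ∈ T <;> simp only [hS, hT, if_true, if_false] at * <;>
      linarith
  ext H
  exact ⟨fun h => (key H (hS h)).1 h, fun h => (key H (hT h)).2 h⟩

theorem regions_ncard (hF : (F : Set (AffineSubspace ℝ V)) = A.hyperplanes)
    (hl : ∀ H ∈ F, ∀ x, x ∈ H ↔ l H x = c H) :
    (A.regions.ncard : ℤ) = cellCount l c ⊤ F := by
  classical
  rw [regions_eq_image hF hl, Set.InjOn.ncard_image, Set.ncard_coe_finset, cellCount,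
    Finset.sum_boole]
  · intro S hS T hT h
    obtain ⟨hS, hne⟩ := Finset.mem_filter.1 (Finset.mem_coe.1 hS)
    obtain ⟨hT, -⟩ := Finset.mem_filter.1 (Finset.mem_coe.1 hT)
    exact cell_injOn (Finset.mem_powerset.1 hS) (Finset.mem_powerset.1 hT) hne h

/-- A nonempty cell is bounded if and only if it has no nonzero recession vector. -/
theorem isBounded_cell_iff [FiniteDimensional ℝ V] {S : Finset (AffineSubspace ℝ V)}
    (hne : (cell l c ⊤ F S).Nonempty) :
    Bornology.IsBounded (cell l c ⊤ F S) ↔ NoRec l ⊤ F S := by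
  obtain ⟨x, hx⟩ := hne
  constructor
  · intro hb v hv hr
    by_contra hv0
    obtain ⟨C, hC⟩ := isBounded_iff_forall_norm_le.1 hb
    have hvn := norm_pos_iff.2 hv0
    have hC0 : 0 ≤ C := (norm_nonneg x).trans (hC x hx)
    -- A displacement of length `C + ‖x‖ + 1` from `x` must leave the ball of radius `C`.
    have ht : 0 ≤ (C + ‖x‖ + 1) / ‖v‖ := by positivity
    have h1 := hC _ (add_smul_mem_cell hx hv hr ht)
    have h2 := norm_sub_le (x + ((C + ‖x‖ + 1) / ‖v‖) • v) x
    rw [add_sub_cancel_left, norm_smul, Real.norm_of_nonneg ht, div_mul_cancel₀ _ hvn.ne'] at h2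
    linarith
  · intro hr
    by_contra hb
    have hex : ∀ k : ℕ, ∃ y ∈ cell l c ⊤ F S, (k : ℝ) + 1 < ‖y - x‖ := by
      intro k
      by_contra! h
      refine hb (isBounded_iff_forall_norm_le.2 ⟨k + 1 + ‖x‖, fun y hy => ?_⟩)
      have := norm_add_le (y - x) x
      rw [sub_add_cancel] at this
      linarith [h y hy]
    choose y hy hyk using hex
    have hpos : ∀ k, 0 < ‖y k - x‖ := fun k => lt_trans (by positivity) (hyk k)
    -- Unit directions towards points escaping to infinity accumulate at a unit vector, which turns
    -- out to be a recession vector.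
    obtain ⟨v, hv, φ, hφ, hlim⟩ := (isCompact_sphere (0 : V) 1).tendsto_subseq
      (x := fun k => ‖y k - x‖⁻¹ • (y k - x)) fun k => by
        rw [mem_sphere_zero_iff_norm, norm_smul, norm_inv, norm_norm,
          inv_mul_cancel₀ (hpos k).ne']
    have hv1 : ‖v‖ = 1 := mem_sphere_zero_iff_norm.1 hv
    have hv0 : v = 0 := by
      refine hr v (by simp) fun H hH => ?_
      set a := sgn S H * (l H x - c H) with ha
      have hinv : Filter.Tendsto (fun k => ‖y (φ k) - x‖⁻¹) Filter.atTop (nhds 0) := by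
        refine Filter.Tendsto.inv_tendsto_atTop ?_
        refine Filter.tendsto_atTop_mono (fun k => ?_) tendsto_natCast_atTop_atTop
        have h1 := hyk (φ k)
        have h2 : (k : ℝ) ≤ φ k := by exact_mod_cast hφ.id_le k
        linarith
      -- The sequence is the cell inequality at `y (φ k)` divided by `‖y (φ k) - x‖`; the constant
      -- part dies in the limit.
      have hL : Filter.Tendsto
          (fun k => sgn S H * l H (‖y (φ k) - x‖⁻¹ • (y (φ k) - x)) + ‖y (φ k) - x‖⁻¹ * a)
          Filter.atTop (nhds (sgn S H * l H v + 0 * a)) :=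
        ((((l H).continuous.tendsto v).comp hlim).const_mul _).add (hinv.mul_const a)
      rw [zero_mul, add_zero] at hL
      refine ge_of_tendsto' hL fun k => ?_
      have h1 := (hy (φ k)).2 H hH
      have h2 := inv_nonneg.2 (norm_nonneg (y (φ k) - x))
      have h3 := mul_nonneg h2 h1.le
      rw [ha]
      simp only [map_smul, map_sub, smul_eq_mul]
      linarith
    rw [hv0, norm_zero] at hv1
    exact zero_ne_one hv1

theorem normalSpace_eq_top [FiniteDimensional ℝ V] (hA : A.IsEssential) : A.normalSpace = ⊤ :=
  Submodule.eq_top_of_finrank_eq hA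

theorem relativelyBoundedRegions_ncard [FiniteDimensional ℝ V] (hA : A.IsEssential)
    (hF : (F : Set (AffineSubspace ℝ V)) = A.hyperplanes)
    (hl : ∀ H ∈ F, ∀ x, x ∈ H ↔ l H x = c H) :
    (A.relativelyBoundedRegions.ncard : ℤ) = boundedCellCount l c ⊤ F := by
  classical
  have himg : A.relativelyBoundedRegions = (fun S => cell l c ⊤ F S) ''
      (F.powerset.filter fun S => (cell l c ⊤ F S).Nonempty ∧ NoRec l ⊤ F S : Finset _) := by
    ext R
    simp only [relativelyBoundedRegions, Set.mem_ofPred_eq, regions_eq_image hF hl, Set.mem_image,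
      Finset.mem_coe, Finset.mem_filter, normalSpace_eq_top hA, Submodule.top_coe, Set.inter_univ]
    constructor
    · rintro ⟨⟨S, ⟨hS, hne⟩, rfl⟩, hb⟩
      exact ⟨S, ⟨hS, hne, (isBounded_cell_iff hne).1 hb⟩, rfl⟩
    · rintro ⟨S, ⟨hS, hne, hb⟩, rfl⟩
      exact ⟨⟨S, ⟨hS, hne⟩, rfl⟩, (isBounded_cell_iff hne).2 hb⟩
  rw [himg, Set.InjOn.ncard_image, Set.ncard_coe_finset, boundedCellCount, Finset.sum_boole]
  · intro S hS T hT h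
    obtain ⟨hS, hne, -⟩ := Finset.mem_filter.1 (Finset.mem_coe.1 hS)
    obtain ⟨hT, -⟩ := Finset.mem_filter.1 (Finset.mem_coe.1 hT)
    exact cell_injOn (Finset.mem_powerset.1 hS) (Finset.mem_powerset.1 hT) hne h

/-- A vector killed by all forms lies in the direction of every hyperplane, so it is orthogonal to
all normals, which span. -/
theorem IsEssential.separates [FiniteDimensional ℝ V] (hA : A.IsEssential)
    (hF : (F : Set (AffineSubspace ℝ V)) = A.hyperplanes)
    (hl : ∀ H ∈ F, ∀ x, x ∈ H ↔ l H x = c H) : Separates l ⊤ F := by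
  intro v _ hv
  have hle : A.normalSpace ≤ (ℝ ∙ v)ᗮ := by
    refine iSup₂_le fun H hH => ?_
    obtain ⟨p, hp⟩ := A.nonempty H hH
    have hHF : H ∈ F := by rwa [← hF] at hH
    refine Submodule.orthogonal_le ?_
    rw [Submodule.span_singleton_le_iff_mem, mem_direction_iff (hl H hHF) hp]
    exact hv H hHF
  rw [normalSpace_eq_top hA, top_le_iff, Submodule.orthogonal_eq_top_iff,
    Submodule.span_singleton_eq_bot] at hle
  exact hle

/-! ### The Möbius function of the intersection poset -/

section Moebius

instance : OrderBot A.IntersectionPoset where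
  bot := ⟨⊤, ⟨0, trivial⟩, ∅, Set.empty_subset _, sInf_empty.symm⟩
  bot_le _ := IntersectionPoset.le_iff.2 le_top

theorem flat_bot : (⊥ : A.IntersectionPoset).flat = ⊤ := rfl

open Classical in
/-- The signed number of sets of hyperplanes with intersection `X`. -/
noncomputable def signedCount (F : Finset (AffineSubspace ℝ V)) (X : A.IntersectionPoset) : ℤ :=
  ∑ B ∈ F.powerset.filter fun B : Finset _ => sInf (B : Set (AffineSubspace ℝ V)) = X.flat,
    (-1) ^ B.card

-- Subsets are grouped by their intersection; those with empty intersection are not in the poset,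
-- but `w ⊥ = 0` discards them.
open Classical in
theorem whitneySum_top (hF : (F : Set (AffineSubspace ℝ V)) = A.hyperplanes)
    [Fintype A.IntersectionPoset] {w : AffineSubspace ℝ V → ℤ} (hw : w ⊥ = 0) :
    whitneySum w ⊤ F = ∑ X : A.IntersectionPoset, signedCount F X * w X.flat := by
  unfold whitneySum signedCount
  simp only [top_inf_eq, Finset.sum_mul]
  rw [Finset.sum_sigma']
  symm
  refine Finset.sum_bij_ne_zero (fun p _ _ => p.2) ?_ ?_ ?_ ?_
  · rintro ⟨Y, B⟩ h _
    simp only [Finset.mem_sigma, Finset.mem_filter, Finset.mem_univ, true_and] at h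
    exact h.1
  · rintro ⟨Y, B⟩ h _ ⟨Y', B'⟩ h' _ e
    simp only [Finset.mem_sigma, Finset.mem_filter, Finset.mem_univ, true_and] at h h'
    dsimp only at e
    subst e
    obtain rfl : Y = Y' := IntersectionPoset.ext (h.2.symm.trans h'.2)
    rfl
  · intro B hB h0
    have hne : ((sInf (B : Set (AffineSubspace ℝ V)) : AffineSubspace ℝ V) : Set V).Nonempty := by
      by_contra hne
      rw [Set.not_nonempty_iff_eq_empty, AffineSubspace.coe_eq_bot_iff] at hne
      rw [hne, hw, mul_zero] at h0
      exact h0 rfl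
    refine ⟨⟨⟨sInf (B : Set (AffineSubspace ℝ V)), hne, B,
      hF ▸ Finset.coe_subset.2 (Finset.mem_powerset.1 hB), rfl⟩, B⟩, ?_, h0, rfl⟩
    simp only [Finset.mem_sigma, Finset.mem_filter, Finset.mem_univ, true_and]
    exact ⟨hB, trivial⟩
  · rintro ⟨Y, B⟩ h _
    simp only [Finset.mem_sigma, Finset.mem_filter, Finset.mem_univ, true_and] at h
    rw [h.2]

variable [FiniteDimensional ℝ V]

theorem grade_add_finrank (X : A.IntersectionPoset) :
    grade ℕ X + Module.finrank ℝ X.flat.direction = Module.finrank ℝ V :=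
  Submodule.finrank_quotient_add_finrank _

theorem grade_bot_eq_zero : grade ℕ (⊥ : A.IntersectionPoset) = 0 := by
  have := grade_add_finrank (⊥ : A.IntersectionPoset)
  rw [flat_bot, AffineSubspace.direction_top, finrank_top] at this
  omega

theorem grade_eq_zero_iff {X : A.IntersectionPoset} : grade ℕ X = 0 ↔ X = ⊥ := by
  refine ⟨fun h => ?_, fun h => h ▸ grade_bot_eq_zero⟩
  by_contra hX
  have := grade_strictMono (𝕆 := ℕ) (bot_lt_iff_ne_bot.2 hX)
  omega

-- This is the defining recursion of the Möbius function. The sets of hyperplanes whose intersection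
-- contains `X` are the subsets of `{H ∈ F | X ⊆ H}`, and their signs cancel unless that set is
-- empty, which happens only for `X = V`.
open Classical in
theorem sum_signedCount (hF : (F : Set (AffineSubspace ℝ V)) = A.hyperplanes)
    [Fintype A.IntersectionPoset] (X : A.IntersectionPoset) :
    ∑ Y ∈ Finset.univ.filter (· ≤ X), signedCount F Y = if X = ⊥ then 1 else 0 := by
  have hp : ∀ B : Finset (AffineSubspace ℝ V), B ∈ (F.filter (X.flat ≤ ·)).powerset ↔
      B ∈ F.powerset ∧ X.flat ≤ sInf (B : Set (AffineSubspace ℝ V)) := by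
    intro B
    simp only [Finset.mem_powerset, Finset.subset_iff, Finset.mem_filter, le_sInf_iff,
      Finset.mem_coe]
    exact ⟨fun h => ⟨fun H hH => (h hH).1, fun H hH => (h hH).2⟩,
      fun h H hH => ⟨h.1 hH, h.2 H hH⟩⟩
  have h1 : ∑ Y ∈ Finset.univ.filter (· ≤ X), signedCount F Y =
      ∑ B ∈ (F.filter (X.flat ≤ ·)).powerset, (-1 : ℤ) ^ B.card := by
    unfold signedCount
    rw [Finset.sum_sigma']
    refine Finset.sum_bij (fun p _ => p.2) ?_ ?_ ?_ fun _ _ => rfl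
    · rintro ⟨Y, B⟩ h
      simp only [Finset.mem_sigma, Finset.mem_filter, Finset.mem_univ, true_and] at h
      exact (hp B).2 ⟨h.2.1, h.2.2 ▸ IntersectionPoset.le_iff.1 h.1⟩
    · rintro ⟨Y, B⟩ h ⟨Y', B'⟩ h' e
      simp only [Finset.mem_sigma, Finset.mem_filter, Finset.mem_univ, true_and] at h h'
      dsimp only at e
      subst e
      obtain rfl : Y = Y' := IntersectionPoset.ext (h.2.2.symm.trans h'.2.2)
      rfl
    · intro B hB
      obtain ⟨hBF, hle⟩ := (hp B).1 hB
      refine ⟨⟨⟨sInf (B : Set (AffineSubspace ℝ V)), X.nonempty.mono hle, B,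
        hF ▸ Finset.coe_subset.2 (Finset.mem_powerset.1 hBF), rfl⟩, B⟩, ?_, rfl⟩
      simp only [Finset.mem_sigma, Finset.mem_filter, Finset.mem_univ, true_and]
      exact ⟨IntersectionPoset.le_iff.2 hle, hBF, trivial⟩
  rw [h1, Finset.sum_powerset_neg_one_pow_card]
  have h2 : F.filter (X.flat ≤ ·) = ∅ ↔ X = ⊥ := by
    rw [Finset.filter_eq_empty_iff]
    constructor
    · intro h
      obtain ⟨B, hB, hX⟩ := X.exists_sInf
      ext1
      rw [flat_bot, hX, sInf_eq_top]
      intro H hH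
      have hHF : H ∈ F := by rw [← Finset.mem_coe, hF]; exact hB hH
      exact absurd (hX ▸ sInf_le hH) (h hHF)
    · rintro rfl H hH hle
      have hHA : H ∈ A.hyperplanes := hF ▸ hH
      have h1 := A.codim_eq_one H hHA
      have h2 := Submodule.finrank_quotient_add_finrank H.direction
      rw [flat_bot, top_le_iff] at hle
      rw [h1, hle, AffineSubspace.direction_top, finrank_top] at h2
      omega
  simp only [h2]

theorem sum_whitney_eq_whitneySum (hF : (F : Set (AffineSubspace ℝ V)) = A.hyperplanes)
    {w : AffineSubspace ℝ V → ℤ} (hw : w ⊥ = 0) {g : ℕ → ℤ}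
    (hg : ∀ X : A.IntersectionPoset, w X.flat = g (grade ℕ X)) :
    ∑ I ∈ (Finset.Icc 1 (Module.finrank ℝ V)).powerset,
      (-1 : ℤ) ^ I.card * g (I.sup id) * (whitney A.IntersectionPoset I : ℤ) =
      whitneySum w ⊤ F := by
  classical
  have := Fintype.ofFinite A.IntersectionPoset
  rw [sum_whitney_eq_sum_chains (fun X => by have := grade_add_finrank X; omega),
    whitneySum_top hF hw]
  have e : (Finset.univ.filter fun X : A.IntersectionPoset => grade ℕ X ≠ 0) =
      Finset.univ.filter fun X => X ≠ ⊥ :=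
    Finset.filter_congr fun X _ => not_congr grade_eq_zero_iff
  simp only [e, hg]
  exact sum_chainsIn_eq_sum_moebius grade_strictMono.monotone grade_bot_eq_zero
    (sum_signedCount hF) g

end Moebius

end HyperplaneArrangement

/-! ### The two counting formulas -/

open HyperplaneArrangement Cells in
theorem mainTheorem3 {V : Type*} [NormedAddCommGroup V] [InnerProductSpace ℝ V]
    [FiniteDimensional ℝ V] (n : ℕ) (hn : Module.finrank ℝ V = n)
    (A : HyperplaneArrangement V) (hA : A.IsEssential) :
    A.regions.Finite ∧
    (A.regions.ncard : ℤ) =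
      ∑ I ∈ (Finset.Icc 1 n).powerset,
        (-1 : ℤ) ^ (I.card + I.sup id) * (whitney A.IntersectionPoset I : ℤ) ∧
    (A.relativelyBoundedRegions.ncard : ℤ) =
      (-1 : ℤ) ^ n * ∑ I ∈ (Finset.Icc 1 n).powerset,
        (-1 : ℤ) ^ I.card * (whitney A.IntersectionPoset I : ℤ) := by
  classical
  subst hn
  have hex : ∀ H : AffineSubspace ℝ V, ∃ p : (V →L[ℝ] ℝ) × ℝ,
      H ∈ A.hyperplanes → ∀ x, x ∈ H ↔ p.1 x = p.2 := by
    intro H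
    by_cases hH : H ∈ A.hyperplanes
    · obtain ⟨l, c, h⟩ := exists_equation H (A.nonempty H hH) (A.codim_eq_one H hH)
      exact ⟨(l, c), fun _ => h⟩
    · exact ⟨0, fun h => absurd h hH⟩
  choose p hp using hex
  set F := A.finite.toFinset
  have hF : (F : Set (AffineSubspace ℝ V)) = A.hyperplanes := A.finite.coe_toFinset
  have hl : ∀ H ∈ F, ∀ x, x ∈ H ↔ (p H).1 x = (p H).2 :=
    fun H hH => hp H (A.finite.mem_toFinset.1 hH)
  refine ⟨?_, ?_, ?_⟩
  · rw [regions_eq_image (l := fun H => (p H).1) (c := fun H => (p H).2) hF hl]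
    exact (Finset.finite_toSet _).image _
  · rw [regions_ncard (l := fun H => (p H).1) (c := fun H => (p H).2) hF hl, cellCount_eq F hl,
      AffineSubspace.direction_top, finrank_top,
      -- Codimension and dimension add up to `n`, so `(-1) ^ dim X = (-1) ^ (n + rk X)`; the extra
      -- `(-1) ^ n` cancels the prefactor from `cellCount_eq`.
      ← sum_whitney_eq_whitneySum hF (by simp [signWeight])
        (g := fun k => (-1) ^ (Module.finrank ℝ V + k)), Finset.mul_sum]
    · refine Finset.sum_congr rfl fun I _ => ?_
      have : ((-1 : ℤ) ^ Module.finrank ℝ V) * (-1) ^ Module.finrank ℝ V = 1 := by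
        rw [← mul_pow]; simp
      rw [pow_add, pow_add]
      linear_combination ((-1 : ℤ) ^ I.card * (-1) ^ I.sup id *
        (whitney A.IntersectionPoset I : ℤ)) * this
    · intro X
      rw [signWeight, if_pos X.nonempty, ← grade_add_finrank X]
      have : ((-1 : ℤ) ^ grade ℕ X) * (-1) ^ grade ℕ X = 1 := by
        rw [← mul_pow]; simp
      rw [pow_add, pow_add]
      linear_combination -((-1 : ℤ) ^ Module.finrank ℝ X.flat.direction) * this
  · rw [relativelyBoundedRegions_ncard (l := fun H => (p H).1) (c := fun H => (p H).2) hA hF hl,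
      boundedCellCount_eq F hl ⊤ (hA.separates hF hl), AffineSubspace.direction_top, finrank_top,
      ← sum_whitney_eq_whitneySum hF (by simp [unitWeight]) (g := fun _ => 1)]
    · simp only [mul_one]
    · intro X
      rw [unitWeight, if_pos X.nonempty]
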